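/- Let $k\ge 3$. A two-coloring of the vertices of a finite simple graph is called valid if no cycle of length $k$ is monochromatic; $(2,k)$-COL is the set of finite graphs that have a valid two-coloring. $k$-NAE-SAT is the set of Boolean formulas in conjunctive normal form in which every clause has at most $k$ literals and for which some truth assignment gives every clause at least one true and at least one false literal. There is a computable function $f$ from Boolean formulas in conjunctive normal form to finite graphs such that, for every formula $\varphi$, $$\varphi\in k\text{-NAE-SAT}\iff f(\varphi)\in(2,k)\text{-COL}.$$ Moreover, $f$ can be chosen of the following form. There are a finite graph $H$ and an edge $\{x,y\}$ of $H$, depending only on $k$, such that $H$ has a valid two-coloring and every valid two-coloring of $H$ gives $x$ and $y$ different colors (a super-edge gadget). For every formula $\varphi$ all of whose clauses have at least one and at most $k$ literals, $f(\varphi)$ is, up to isomorphism, the following graph: it has two vertices $v,\neg v$ for each variable $v$ of $\varphi$ and a $k$-cycle for each clause, whose consecutive vertices are labeled by the consecutive literals of the clause (repeated cyclically if there are fewer than $k$). In addition, each pair $v,\neg v$, and each pair consisting of a vertex of a clause cycle and the literal vertex that it is labeled with, is joined by its own copy of $H$, with $x$ and $y$ identified with the two vertices of the pair (with $v$ and $\neg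 v$, respectively with the literal vertex and the clause vertex) and all other vertices new. -/

import Mathlib

/-- A literal: `(v, true)` is the variable `v`, `(v, false)` is its negation. -/
abbrev NaeLiteral : Type := ℕ × Bool

/-- A clause: the list of its literals. -/
abbrev NaeClause : Type := List NaeLiteral

/-- A Boolean formula in conjunctive normal form: the list of its clauses. -/
abbrev NaeFormula : Type := List NaeClause

/-- The literal `l` is true under the truth assignment `σ`. -/
def NaeLiteral.IsTrue (σ : ℕ → Bool) (l : NaeLiteral) : Prop := σ l.1 = l.2

/-- Some literal of the clause is true under `σ` and some literal is false. -/
def NaeClause.Holds (σ : ℕ → Bool) (C : NaeClause) : Prop :=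
  (∃ l ∈ C, NaeLiteral.IsTrue σ l) ∧ (∃ l ∈ C, ¬ NaeLiteral.IsTrue σ l)

/-- `k-NAE-SAT`: the formulas all of whose clauses have at most `k` literals and for which a
single truth assignment gives every clause a true literal and a false literal. -/
def NaeSat (k : ℕ) : Set NaeFormula :=
  {φ | (∀ C ∈ φ, C.length ≤ k) ∧ ∃ σ : ℕ → Bool, ∀ C ∈ φ, NaeClause.Holds σ C}

/-- The two-coloring `c` of `G` is valid: no cycle of length `k` is monochromatic. -/
def ValidColoring {V : Type*} (k : ℕ) (G : SimpleGraph V) (c : V → Bool) : Prop :=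
  ∀ (v : V) (p : G.Walk v v), p.IsCycle → p.length = k →
    ∃ a ∈ p.support, ∃ b ∈ p.support, c a ≠ c b

/-- A finite graph given as data: the number `n` of vertices, which are `0, …, n - 1`, and a list
of pairs of end points of edges (the order within a pair, repetitions, loops and pairs with a
component that is not a vertex do not matter). -/
abbrev GraphCode : Type := ℕ × List (ℕ × ℕ)

/-- The simple graph that a code describes. -/
def GraphCode.graph (g : GraphCode) : SimpleGraph (Fin g.1) :=
  SimpleGraph.fromRel fun u v => (u.1, v.1) ∈ g.2

/-- `(2,k)-COL`: the finite graphs that have a valid two-coloring. -/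
def TwoCol (k : ℕ) : Set GraphCode :=
  {g | ∃ c : Fin g.1 → Bool, ValidColoring k g.graph c}

/-- `H` with the selected edge `{x, y}` is a super-edge gadget: it has a valid coloring, and every
valid coloring gives `x` and `y` different colors. -/
def IsSuperEdge {W : Type*} (k : ℕ) (H : SimpleGraph W) (x y : W) : Prop :=
  H.Adj x y ∧ (∃ c : W → Bool, ValidColoring k H c) ∧
    ∀ c : W → Bool, ValidColoring k H c → c x ≠ c y

/-- The literal at position `j` of the `i`-th clause, the literals of a nonempty clause with fewer
than `k` literals being repeated cyclically to fill `k` positions. -/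
def NaeFormula.litAt (φ : NaeFormula) (k : ℕ) (i : Fin φ.length) (j : Fin k) : NaeLiteral :=
  (φ.get i).getD (j.1 % (φ.get i).length) (0, true)

namespace Reduction

variable {m k : ℕ} (L : Fin m → Fin k → NaeLiteral) {W : Type*} (H : SimpleGraph W) (x y : W)

/-- The variables that occur in the `m` clauses `L i`, each with `k` positions. -/
abbrev Vars : Type := {v : ℕ // ∃ i j, (L i j).1 = v}

/-- The vertices of the variable gadgets (two for each variable, `(v, true)` for `v` and
`(v, false)` for its negation) and those of the clause gadgets (`k` for each clause). -/
abbrev Core : Type := (Vars L × Bool) ⊕ (Fin m × Fin k)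

/-- The super-edges: one for each variable and one for each position of each clause. -/
abbrev Sup : Type := Vars L ⊕ (Fin m × Fin k)

/-- The first end of a super-edge: the vertex `v` for the super-edge of a variable `v`, the vertex
of the literal in its variable gadget for that of a clause position. -/
def src : Sup L → Core L
  | .inl v => .inl (v, true)
  | .inr (i, j) => .inl (⟨(L i j).1, i, j, rfl⟩, (L i j).2)

/-- The second end of a super-edge: the vertex `¬ v` for the super-edge of a variable `v`, the
vertex of the clause gadget for that of a clause position. -/
def tgt : Sup L → Core L
  | .inl v => .inl (v, false)
  | .inr (i, j) => .inr (i, j)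

/-- The vertices of the whole graph: besides those of the variable and clause gadgets, the vertices
other than `x` and `y` of a copy of the super-edge gadget for every super-edge. -/
abbrev Vert : Type _ := Core L ⊕ (Sup L × {w : W // w ≠ x ∧ w ≠ y})

open Classical in
/-- The copy of the super-edge gadget at `s`: `x` and `y` go to the two ends of `s`, every other
vertex to a vertex of its own. -/
noncomputable def copy (s : Sup L) (w : W) : Vert L x y :=
  if hx : w = x then .inl (src L s)
  else if hy : w = y then .inl (tgt L s)
  else .inr (s, ⟨w, hx, hy⟩)

/-- The graph made of a `k`-cycle for each clause and a copy of the gadget `H` for each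
super-edge. -/
noncomputable def graph : SimpleGraph (Vert L x y) :=
  SimpleGraph.fromRel fun a b =>
    (∃ i j j', (SimpleGraph.cycleGraph k).Adj j j' ∧
      a = .inl (.inr (i, j)) ∧ b = .inl (.inr (i, j'))) ∨
    (∃ s w w', H.Adj w w' ∧ a = copy L x y s w ∧ b = copy L x y s w')

end Reduction

/-! In a clique, any `k` vertices of one color contain a monochromatic `k`-cycle, so a valid
coloring uses each color on fewer than `k` clique vertices. This pigeonhole bound forces colors in a
super-edge gadget built on a clique with `2k - 2` vertices (`isSuperEdge_cliqueGadget`); the cycle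
used there has at least four vertices, so `k = 3` gets its own gadget.

In the reduction, super-edges make `v` and `¬v` differ and give each clause vertex the color
opposite to its literal. Hence a clause cycle is non-monochromatic exactly when the clause has a
true and a false literal. Conversely, an assignment colors the core, and each copy takes a valid
gadget coloring, flipped if necessary. A monochromatic cycle contains at most one end of each
super-edge; since a cycle minus a vertex is connected, it lies in one copy or is a whole clause
cycle, and both are excluded (`validColoring_coloring`).

Formulas with an empty or too long clause are sent to the complete graph on `2k - 1` vertices.
Computability follows by naming vertices with numbers and listing vertices and edges primitive
recursively. -/

open SimpleGraph

/-! ### Monochromatic cycles and cliques. -/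

theorem ValidColoring.comap {V W : Type*} {k : ℕ} {G : SimpleGraph V} {G' : SimpleGraph W}
    {c : W → Bool} (hc : ValidColoring k G' c) (f : G →g G') (hf : Function.Injective f) :
    ValidColoring k G (c ∘ f) := by
  intro v p hp hl
  obtain ⟨a, ha, b, hb, hab⟩ := hc (f v) (p.map f) (hp.map hf) (by simpa using hl)
  rw [Walk.support_map, List.mem_map] at ha hb
  obtain ⟨a, ha, rfl⟩ := ha
  obtain ⟨b, hb, rfl⟩ := hb
  exact ⟨a, ha, b, hb, hab⟩

theorem exists_validColoring_congr {V W : Type*} {k : ℕ} {G : SimpleGraph V} {G' : SimpleGraph W}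
    (e : G ≃g G') : (∃ c, ValidColoring k G c) ↔ ∃ c, ValidColoring k G' c :=
  ⟨fun ⟨_, hc⟩ => ⟨_, hc.comap e.symm.toHom e.symm.injective⟩,
    fun ⟨_, hc⟩ => ⟨_, hc.comap e.toHom e.injective⟩⟩

theorem exists_isCycle_of_isChain {V : Type*} {G : SimpleGraph V} {a b d : V} {l : List V}
    (hc : List.IsChain G.Adj (a :: b :: d :: l)) (hn : (a :: b :: d :: l).Nodup)
    (hlast : G.Adj ((d :: l).getLast (List.cons_ne_nil d l)) a) :
    ∃ (v : V) (p : G.Walk v v), p.IsCycle ∧ p.length = l.length + 3 ∧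
      ∀ u ∈ p.support, u ∈ a :: b :: d :: l := by
  obtain ⟨r, hr⟩ : ∃ r : G.Walk b ((d :: l).getLast (List.cons_ne_nil d l)),
      r.support = b :: d :: l :=
    ⟨Walk.ofSupport (b :: d :: l) (List.cons_ne_nil _ _) hc.of_cons, Walk.support_ofSupport _ _⟩
  have hlen : r.length = l.length + 1 := by
    have := r.length_support
    rw [hr] at this
    simpa using this.symm
  have ha : a ∉ r.support := hr ▸ (List.nodup_cons.1 hn).1
  refine ⟨_, Walk.cons hlast (Walk.cons hc.rel r), ?_, ?_, ?_⟩
  · rw [Walk.cons_isCycle_iff]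
    refine ⟨by rw [Walk.isPath_def, Walk.support_cons, hr]; exact hn, ?_⟩
    rw [Walk.edges_cons, List.mem_cons, not_or]
    constructor
    -- The closing edge is not `{a, b}`: its other end lies in `d :: l`, which omits `b`.
    · have hm : (d :: l).getLast (List.cons_ne_nil d l) ∈ d :: l := List.getLast_mem _
      rw [Sym2.eq_iff]
      grind
    · exact fun h => ha (Walk.snd_mem_support_of_mem_edges _ h)
  · rw [Walk.length_cons, Walk.length_cons, hlen]
  · intro u hu
    rw [Walk.support_cons, Walk.support_cons, hr, List.mem_cons] at hu
    rcases hu with rfl | hu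
    · exact List.mem_cons_of_mem _ (List.mem_cons_of_mem _ (List.getLast_mem _))
    · exact hu

theorem ValidColoring.false_of_isChain {V : Type*} {G : SimpleGraph V} {c : V → Bool} {k : ℕ}
    (hk : 3 ≤ k) (hc : ValidColoring k G c) {a : V} {l : List V}
    (hch : List.IsChain G.Adj (a :: l)) (hn : (a :: l).Nodup) (hl : l.length + 1 = k)
    (hlast : ∀ z ∈ l.getLast?, G.Adj z a) {τ : Bool} (hm : ∀ u ∈ a :: l, c u = τ) : False := by
  match l, hl with
  | [], hl => simp at hl; omega
  | [_], hl => simp at hl; omega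
  | b :: d :: l, hl =>
    obtain ⟨v, p, hp, hpl, hs⟩ := exists_isCycle_of_isChain hch hn
      (hlast _ (by rw [List.getLast?_eq_getLast_of_ne_nil (List.cons_ne_nil _ _)]; simp))
    obtain ⟨x, hx, y, hy, hxy⟩ := hc v p hp (by rw [hpl, ← hl]; simp)
    exact hxy ((hm _ (hs x hx)).trans (hm _ (hs y hy)).symm)

theorem ValidColoring.card_lt_of_isClique {V : Type*} {G : SimpleGraph V} {c : V → Bool} {k : ℕ}
    (hk : 3 ≤ k) (hc : ValidColoring k G c) {s : Finset V} (hs : G.IsClique s) {τ : Bool}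
    (hm : ∀ u ∈ s, c u = τ) : s.card < k := by
  by_contra! h
  obtain ⟨t, hts, htk⟩ := Finset.exists_subset_card_eq h
  have hpair : ∀ l : List V, (∀ u ∈ l, u ∈ t) → l.Nodup → l.IsChain G.Adj := by
    intro l hl hn
    refine List.Pairwise.isChain ?_
    refine hn.imp_of_mem ?_
    intro x y hx hy hxy
    exact hs (hts (hl _ hx)) (hts (hl _ hy)) hxy
  obtain hnil | ⟨a, l, hal⟩ : t.toList = [] ∨ ∃ a l, t.toList = a :: l := by
    cases t.toList <;> simp
  · have := congrArg List.length hnil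
    simp at this; simp [this] at htk; omega
  · have hmem : ∀ u, u ∈ a :: l ↔ u ∈ t := by simp [← hal]
    have hn : (a :: l).Nodup := hal ▸ t.nodup_toList
    refine hc.false_of_isChain hk (hpair _ (fun u => (hmem u).1) hn) hn
      (by rw [← htk, ← t.length_toList, hal]; simp) ?_ (fun u hu => hm u (hts ((hmem u).1 hu)))
    intro z hz
    have hz := List.mem_of_mem_getLast? hz
    refine hs (hts ((hmem z).1 (List.mem_cons_of_mem _ hz))) (hts ((hmem a).1 (by simp))) ?_
    rintro rfl
    exact (List.nodup_cons.1 hn).1 hz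

/-- Two color classes of at most `k - 1` vertices cannot cover `2k - 1`. -/
theorem not_validColoring_of_isClique {V : Type*} [Fintype V] {G : SimpleGraph V} {k : ℕ}
    (hk : 3 ≤ k) {s : Finset V} (hs : G.IsClique s) (hcard : 2 * k - 1 ≤ s.card)
    (c : V → Bool) : ¬ ValidColoring k G c := by
  intro hc
  have h : ∀ τ, (s.filter (c · = τ)).card < k := fun τ =>
    hc.card_lt_of_isClique hk (hs.subset (Finset.coe_subset.2 (Finset.filter_subset _ s)))
      (τ := τ) (by simp)
  have h1 := h true
  have h2 := h false
  have := Finset.card_filter_add_card_filter_not (s := s) (c · = true)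
  simp only [Bool.not_eq_true] at this
  omega

namespace SimpleGraph.Walk.IsCycle

variable {V : Type*} {G : SimpleGraph V} {v : V} {p : G.Walk v v}

/-- A cycle has as many distinct vertices as its length, so it exhausts any set of at most that size
in which it lies. -/
theorem mem_support_of_card_le (hp : p.IsCycle) {s : Finset V} (hs : ∀ u ∈ p.support, u ∈ s)
    (hcard : s.card ≤ p.length) {u : V} (hu : u ∈ s) : u ∈ p.support := by
  classical
  have hsub : p.support.tail.toFinset ⊆ s := fun w hw =>
    hs w (List.mem_of_mem_tail (List.mem_toFinset.1 hw))
  have hc : p.support.tail.toFinset.card = p.length := by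
    rw [List.toFinset_card_of_nodup hp.support_nodup, List.length_tail, p.length_support]
    rfl
  have := Finset.eq_of_subset_of_card_le hsub (by rw [hc]; exact hcard)
  rw [← this] at hu
  exact List.mem_of_mem_tail (List.mem_toFinset.1 hu)

theorem exists_two_neighbors (hp : p.IsCycle) {u : V} (hu : u ∈ p.support) :
    ∃ a ∈ p.support, ∃ b ∈ p.support, a ≠ b ∧ G.Adj u a ∧ G.Adj u b := by
  classical
  have hq := hp.rotate hu
  have hm : ∀ w, w ∈ (p.rotate u hu).support ↔ w ∈ p.support := fun w =>
    Walk.mem_support_rotate_iff ..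
  exact ⟨_, (hm _).1 (Walk.getVert_mem_support ..), _, (hm _).1 (Walk.getVert_mem_support ..),
    hq.snd_ne_penultimate, Walk.adj_snd hq.not_nil, (Walk.adj_penultimate hq.not_nil).symm⟩

end SimpleGraph.Walk.IsCycle

theorem SimpleGraph.IsClique.exists_path {V : Type*} {G : SimpleGraph V} {s : Finset V}
    (hs : G.IsClique s) {u w : V} (hu : u ∈ s) (hw : w ∈ s) (huw : u ≠ w) {m : ℕ}
    (hm : m + 2 ≤ s.card) :
    ∃ l : List V, l.length = m ∧ (u :: (l ++ [w])).Nodup ∧ (∀ a ∈ u :: (l ++ [w]), a ∈ s) ∧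
      (u :: (l ++ [w])).IsChain G.Adj := by
  classical
  have hc : m ≤ ((s.erase u).erase w).card := by
    rw [Finset.card_erase_of_mem (by simp [hw, huw.symm]), Finset.card_erase_of_mem hu]
    omega
  obtain ⟨t, hts, htm⟩ := Finset.exists_subset_card_eq hc
  have ht : ∀ a ∈ t, a ≠ w ∧ a ≠ u ∧ a ∈ s := fun a ha => by simpa using hts ha
  have hn : (u :: (t.toList ++ [w])).Nodup := by
    rw [List.nodup_cons, List.nodup_append]
    refine ⟨?_, t.nodup_toList, by simp, ?_⟩
    · simp only [List.mem_append, Finset.mem_toList, List.mem_singleton, not_or]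
      exact ⟨fun h => (ht u h).2.1 rfl, huw⟩
    · simp only [Finset.mem_toList, List.mem_singleton, forall_eq]
      exact fun a ha => (ht a ha).1
  have hmem : ∀ a ∈ u :: (t.toList ++ [w]), a ∈ s := by
    simp only [List.mem_cons, List.mem_append, Finset.mem_toList, List.not_mem_nil, or_false]
    rintro a (rfl | ha | rfl)
    exacts [hu, (ht a ha).2.2, hw]
  exact ⟨t.toList, by simpa using htm, hn, hmem, List.Pairwise.isChain
    (hn.imp_of_mem fun ha hb hab => hs (hmem _ ha) (hmem _ hb) hab)⟩

/-- A `k`-cycle can be closed up through a vertex with two neighbors in a monochromatic clique. -/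
theorem ValidColoring.false_of_two_neighbors {V : Type*} {G : SimpleGraph V} {c : V → Bool}
    {k : ℕ} (hk : 3 ≤ k) (hc : ValidColoring k G c) {s : Finset V} (hs : G.IsClique s)
    (hcard : k ≤ s.card + 1) {y u w : V} (hy : y ∉ s) (hu : u ∈ s) (hw : w ∈ s) (huw : u ≠ w)
    (hyu : G.Adj y u) (hyw : G.Adj w y) {τ : Bool} (hsτ : ∀ a ∈ s, c a = τ) (hyτ : c y = τ) :
    False := by
  -- Together with `y`, `u` and `w` this makes `k` vertices.
  obtain ⟨l, hl, hn, hmem, hch⟩ := hs.exists_path hu hw huw (m := k - 3) (by omega)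
  refine hc.false_of_isChain hk (a := y) (l := u :: (l ++ [w])) (List.isChain_cons_cons.2 ⟨hyu, hch⟩)
    (List.nodup_cons.2 ⟨fun h => hy (hmem _ h), hn⟩) (by simp; omega) ?_ (τ := τ) ?_
  · rw [← List.cons_append, List.getLast?_concat]
    simpa using hyw
  · intro a ha
    rcases List.mem_cons.1 ha with rfl | ha
    exacts [hyτ, hsτ a (hmem a ha)]

/-! ### The super-edge gadget for `k ≥ 4`. -/

/-- The adjacency of the super-edge gadget for `k ≥ 4`: a clique on the first `2k - 2` vertices, a
vertex `2k - 2` joined to the first `k` of them, and a vertex `2k - 1` joined to the two vertices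
before it. -/
def cliqueGadgetRel (k a b : ℕ) : Prop :=
  (a < 2 * k - 2 ∧ b < 2 * k - 2) ∨ (a = 2 * k - 2 ∧ (b < k ∨ b = 2 * k - 1)) ∨
    (a = 2 * k - 1 ∧ b = 2 * k - 3)

/-- The super-edge gadget for `k ≥ 4`. -/
def cliqueGadget (k : ℕ) : SimpleGraph (Fin (2 * k)) :=
  SimpleGraph.fromRel fun a b => cliqueGadgetRel k a b

theorem cliqueGadget_adj {k : ℕ} {a b : Fin (2 * k)} : (cliqueGadget k).Adj a b ↔
    a.1 ≠ b.1 ∧ (cliqueGadgetRel k a b ∨ cliqueGadgetRel k b a) := by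
  rw [cliqueGadget, SimpleGraph.fromRel_adj, Ne, Fin.ext_iff]

theorem exists_validColoring_cliqueGadget {k : ℕ} (hk : 4 ≤ k) :
    ∃ c, ValidColoring k (cliqueGadget k) c := by
  -- Both classes have `k` vertices, so a monochromatic `k`-cycle would use a whole class; each
  -- class contains a vertex with too few neighbors in it.
  refine ⟨fun a => decide (a.1 < k - 1 ∨ a.1 = 2 * k - 1), ?_⟩
  intro v p hp hl
  by_contra! hmono
  have hmono' : ∀ a ∈ p.support, ∀ b ∈ p.support,
      (a.1 < k - 1 ∨ a.1 = 2 * k - 1) ↔ (b.1 < k - 1 ∨ b.1 = 2 * k - 1) :=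
    fun a ha b hb => decide_eq_decide.1 (hmono a ha b hb)
  by_cases hv : v.1 < k - 1 ∨ v.1 = 2 * k - 1
  · have hsup : ∀ a ∈ p.support, a.1 < k - 1 ∨ a.1 = 2 * k - 1 := fun a ha =>
      (hmono' a ha v p.start_mem_support).2 hv
    let s : Finset (Fin (2 * k)) := {a | a.1 < k - 1 ∨ a.1 = 2 * k - 1}
    have hs : s.card ≤ k := by
      refine (?_ : _ ≤ (Finset.range k).card).trans_eq (Finset.card_range k)
      refine Finset.card_le_card_of_injOn (fun a => if a.1 = 2 * k - 1 then k - 1 else a.1) ?_ ?_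
      · intro a ha
        have : a.1 < k - 1 ∨ a.1 = 2 * k - 1 := by simpa [s] using ha
        simp only [Finset.coe_range, Set.mem_Iio]
        split_ifs <;> omega
      · intro a ha b hb hab
        have ha : a.1 < k - 1 ∨ a.1 = 2 * k - 1 := by simpa [s] using ha
        have hb : b.1 < k - 1 ∨ b.1 = 2 * k - 1 := by simpa [s] using hb
        ext
        dsimp only at hab
        split_ifs at hab <;> omega
    have hz := hp.mem_support_of_card_le (s := s) (fun u hu => by simpa [s] using hsup u hu)
      (by omega) (u := ⟨2 * k - 1, by omega⟩) (by simp [s])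
    -- The neighbors `2k - 3` and `2k - 2` of `2k - 1` both have the other color.
    obtain ⟨a, ha, -, -, -, hadj, -⟩ := hp.exists_two_neighbors hz
    have := hsup a ha
    rw [cliqueGadget_adj, cliqueGadgetRel, cliqueGadgetRel] at hadj
    dsimp only at hadj
    omega
  · have hsup : ∀ a ∈ p.support, ¬ (a.1 < k - 1 ∨ a.1 = 2 * k - 1) := fun a ha =>
      (not_congr (hmono' a ha v p.start_mem_support)).2 hv
    let s : Finset (Fin (2 * k)) := {a | ¬ (a.1 < k - 1 ∨ a.1 = 2 * k - 1)}
    have hs : s.card ≤ k := by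
      refine (?_ : _ ≤ (Finset.range k).card).trans_eq (Finset.card_range k)
      refine Finset.card_le_card_of_injOn (fun a => a.1 - (k - 1)) ?_ ?_
      · intro a ha
        have : ¬ (a.1 < k - 1 ∨ a.1 = 2 * k - 1) := by simpa [s] using ha
        simp only [Finset.coe_range, Set.mem_Iio]
        omega
      · intro a ha b hb hab
        have ha : ¬ (a.1 < k - 1 ∨ a.1 = 2 * k - 1) := by simpa [s] using ha
        have hb : ¬ (b.1 < k - 1 ∨ b.1 = 2 * k - 1) := by simpa [s] using hb
        ext
        dsimp only at hab
        omega
    have hy := hp.mem_support_of_card_le (s := s) (fun u hu => by simpa [s] using hsup u hu)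
      (by omega) (u := ⟨2 * k - 2, by omega⟩) (by simp [s]; omega)
    -- The only neighbor of `2k - 2` in its own class is `k - 1`.
    obtain ⟨a, ha, b, hb, hab, hadj, hadj'⟩ := hp.exists_two_neighbors hy
    have := hsup a ha
    have := hsup b hb
    rw [cliqueGadget_adj, cliqueGadgetRel, cliqueGadgetRel] at hadj hadj'
    dsimp only at hadj hadj'
    rw [Ne, Fin.ext_iff] at hab
    omega

theorem card_fin_lt {n m : ℕ} (h : m ≤ n) :
    (Finset.univ.filter fun a : Fin n => a.1 < m).card = m := by
  rw [Fin.card_filter_val_lt, min_eq_right h]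

theorem isSuperEdge_cliqueGadget {k : ℕ} (hk : 4 ≤ k) :
    IsSuperEdge k (cliqueGadget k) ⟨2 * k - 1, by omega⟩ ⟨2 * k - 2, by omega⟩ := by
  refine ⟨?_, exists_validColoring_cliqueGadget hk, ?_⟩
  · rw [cliqueGadget_adj, cliqueGadgetRel, cliqueGadgetRel]
    dsimp only
    omega
  intro c hc hzy
  set z : Fin (2 * k) := ⟨2 * k - 1, by omega⟩ with hz
  set y : Fin (2 * k) := ⟨2 * k - 2, by omega⟩ with hy
  set x : Fin (2 * k) := ⟨2 * k - 3, by omega⟩ with hx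
  have hzv : z.1 = 2 * k - 1 := rfl
  have hyv : y.1 = 2 * k - 2 := rfl
  have hxv : x.1 = 2 * k - 3 := rfl
  obtain ⟨τ, hτ⟩ : ∃ τ, c y = τ := ⟨_, rfl⟩
  let Q : Finset (Fin (2 * k)) := {a | a.1 < 2 * k - 2}
  let B : Finset (Fin (2 * k)) := {a | a.1 < k}
  have hQ : (cliqueGadget k).IsClique (Q : Set (Fin (2 * k))) := by
    intro a ha b hb hab
    have ha : a.1 < 2 * k - 2 := by simpa [Q] using ha
    have hb : b.1 < 2 * k - 2 := by simpa [Q] using hb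
    rw [Ne, Fin.ext_iff] at hab
    rw [cliqueGadget_adj, cliqueGadgetRel, cliqueGadgetRel]
    omega
  have hQc : Q.card = 2 * k - 2 := card_fin_lt (by omega)
  have hBc : B.card = k := card_fin_lt (by omega)
  have hBQ : B ⊆ Q := fun a ha => by
    have : a.1 < k := by simpa [B] using ha
    have : a.1 < 2 * k - 2 := by omega
    simpa [Q] using this
  have hclique : ∀ σ, (cliqueGadget k).IsClique (Q.filter (c · = σ) : Set (Fin (2 * k))) :=
    fun σ => hQ.subset (Finset.coe_subset.2 (Finset.filter_subset _ Q))
  have hlt : ∀ σ, (Q.filter (c · = σ)).card < k := fun σ =>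
    hc.card_lt_of_isClique (by omega) (hclique σ) (τ := σ) (by simp)
  let A := Q.filter (c · = τ)
  let A' := Q.filter (¬ c · = τ)
  have hA'eq : A' = Q.filter (c · = !τ) := by
    refine Finset.filter_congr fun a _ => ?_
    cases c a <;> cases τ <;> simp
  have hadd : A.card + A'.card = Q.card := Finset.card_filter_add_card_filter_not _
  have hA : A.card < k := hlt τ
  have hA' : A'.card < k := hA'eq ▸ hlt _
  have hyB : ∀ b ∈ B, (cliqueGadget k).Adj y b := by
    intro b hb
    have hb : b.1 < k := by simpa [B] using hb
    rw [cliqueGadget_adj, cliqueGadgetRel, cliqueGadgetRel]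
    omega
  have hyQ : y ∉ Q := by simp [Q, hy]
  -- Both classes of `Q` have exactly `k - 1` vertices. Two neighbors of `y` in `A` would let `y`
  -- and `A` close up to a `k`-cycle of color `τ`.
  have hAB : (B.filter (c · = τ)).card ≤ 1 := by
    rw [Finset.card_le_one]
    intro a ha b hb
    rw [Finset.mem_filter] at ha hb
    by_contra hab
    exact hc.false_of_two_neighbors (by omega) (hclique τ) (y := y) (u := a) (w := b)
      (show k ≤ A.card + 1 by omega)
      (fun h => hyQ (Finset.mem_filter.1 h).1) (Finset.mem_filter.2 ⟨hBQ ha.1, ha.2⟩)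
      (Finset.mem_filter.2 ⟨hBQ hb.1, hb.2⟩) hab (hyB a ha.1) (hyB b hb.1).symm (τ := τ)
      (by simp) hτ
  have haddB : (B.filter (c · = τ)).card + (B.filter (¬ c · = τ)).card = B.card :=
    Finset.card_filter_add_card_filter_not _
  have hsub : B.filter (¬ c · = τ) ⊆ A' := Finset.filter_subset_filter _ hBQ
  have hle := Finset.card_le_card hsub
  -- At least `k - 1` of the `k` vertices of `B` lie in `A'`, which has only `k - 1`. So `A'` lies
  -- in `B`, and `x`, being outside `B`, is in `A`.
  have hA'B : B.filter (¬ c · = τ) = A' := Finset.eq_of_subset_of_card_le hsub (by omega)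
  have hxQ : x ∈ Q := by simp [Q, hx]; omega
  have hxA : x ∈ A := by
    by_contra h
    have : x ∈ A' := Finset.mem_filter.2 ⟨hxQ, fun h' => h (Finset.mem_filter.2 ⟨hxQ, h'⟩)⟩
    rw [← hA'B, Finset.mem_filter] at this
    have := this.1
    simp [B, hx] at this
    omega
  obtain ⟨b, hb⟩ := Finset.card_pos.1 (show 0 < (B.filter (c · = τ)).card by omega)
  rw [Finset.mem_filter] at hb
  have hbx : b ≠ x := by
    rintro rfl
    have := hb.1
    simp [B, hx] at this
    omega
  -- The contradiction is the cycle `z, y, b, …, x` in color `τ`: four named vertices and `k - 4`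
  -- others, whence `k ≥ 4`.
  obtain ⟨l, hl, hn, hmem, hch⟩ := (hclique τ).exists_path (Finset.mem_filter.2 ⟨hBQ hb.1, hb.2⟩)
    hxA hbx (m := k - 4) (show k - 4 + 2 ≤ A.card by omega)
  have hzadj : (cliqueGadget k).Adj z y := by
    rw [cliqueGadget_adj, cliqueGadgetRel, cliqueGadgetRel]
    omega
  have hxz : (cliqueGadget k).Adj x z := by
    rw [cliqueGadget_adj, cliqueGadgetRel, cliqueGadgetRel]
    omega
  have hzQ : z ∉ Q := by simp [Q, hz]; omega
  refine hc.false_of_isChain (by omega) (a := z) (l := y :: b :: (l ++ [x]))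
    (List.isChain_cons_cons.2 ⟨hzadj, List.isChain_cons_cons.2 ⟨hyB b hb.1, hch⟩⟩)
    ?_ (by simp; omega) ?_ (τ := τ) ?_
  · refine List.nodup_cons.2 ⟨?_, List.nodup_cons.2
      ⟨fun h => hyQ (Finset.mem_filter.1 (hmem _ h)).1, hn⟩⟩
    rw [List.mem_cons, not_or]
    exact ⟨hzadj.ne, fun h => hzQ (Finset.mem_filter.1 (hmem _ h)).1⟩
  · rw [← List.cons_append, ← List.cons_append, List.getLast?_concat]
    simpa using hxz
  · intro a ha
    rcases List.mem_cons.1 ha with rfl | ha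
    · rw [hzy, hτ]
    rcases List.mem_cons.1 ha with rfl | ha
    · exact hτ
    · exact (Finset.mem_filter.1 (hmem a ha)).2

/-! ### The super-edge gadget for `k = 3`. -/

/-- The super-edge gadget for triangles: the triangles `0, 1, 2` and `5, 6, 7` force the
vertices `3`, `4`, `8` to have one color, and `3`, `8`, `9` form a triangle. -/
def triangleGadget : SimpleGraph (Fin 10) :=
  SimpleGraph.fromRel fun a b => (a, b) ∈
    ([(0, 1), (0, 2), (1, 2), (3, 0), (3, 1), (3, 2), (4, 0), (4, 1), (4, 2), (4, 5), (4, 6),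
      (4, 7), (5, 6), (5, 7), (6, 7), (8, 5), (8, 6), (8, 7), (3, 8), (9, 3), (9, 8)] :
      List (Fin 10 × Fin 10))

instance : DecidableRel triangleGadget.Adj :=
  inferInstanceAs (DecidableRel (SimpleGraph.fromRel _).Adj)

theorem ValidColoring.ne_or_ne_of_triangle {V : Type*} {G : SimpleGraph V} {c : V → Bool}
    (hc : ValidColoring 3 G c) {a b d : V} (hab : G.Adj a b) (hbd : G.Adj b d) (hda : G.Adj d a) :
    c a ≠ c b ∨ c b ≠ c d := by
  by_contra! h
  refine hc.false_of_isChain le_rfl (a := a) (l := [b, d])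
    (by simp [hab, hbd]) (by simp [hab.ne, hbd.ne, hda.ne']) rfl (by simpa using hda)
    (τ := c a) (by simp [h.1, h.2])

theorem validColoring_three {V : Type*} {G : SimpleGraph V} {c : V → Bool}
    (h : ∀ a b d, G.Adj a b → G.Adj b d → G.Adj d a → c a ≠ c b ∨ c b ≠ c d) :
    ValidColoring 3 G c := by
  intro v p _ hl
  match p, hl with
  | .cons (v := b) h₁ (.cons (v := d) h₂ (.cons h₃ .nil)), _ =>
    rcases h _ _ _ h₁ h₂ h₃ with h | h
    · exact ⟨v, by simp, b, by simp, h⟩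
    · exact ⟨b, by simp, d, by simp, h⟩

/-- Two of `a`, `b`, `d` agree, and a vertex joined to all three must avoid their majority color. So
`u` and `w` both have the minority color. -/
theorem eq_of_triangles {a b d u w : Bool} (h : a ≠ b ∨ b ≠ d) (h₁ : u ≠ a ∨ a ≠ b)
    (h₂ : u ≠ a ∨ a ≠ d) (h₃ : u ≠ b ∨ b ≠ d) (h₄ : w ≠ a ∨ a ≠ b) (h₅ : w ≠ a ∨ a ≠ d)
    (h₆ : w ≠ b ∨ b ≠ d) : u = w := by
  cases a <;> cases b <;> cases d <;> cases u <;> simp_all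

theorem isSuperEdge_triangleGadget : IsSuperEdge 3 triangleGadget 9 3 := by
  refine ⟨by decide, ⟨fun a => decide (a ∈ ([2, 3, 4, 7, 8] : List (Fin 10))), ?_⟩, ?_⟩
  · exact validColoring_three (by decide)
  · intro c hc
    have T : ∀ a b d, triangleGadget.Adj a b ∧ triangleGadget.Adj b d ∧ triangleGadget.Adj d a →
        c a ≠ c b ∨ c b ≠ c d := fun a b d h => hc.ne_or_ne_of_triangle h.1 h.2.1 h.2.2
    have e₁ : c 3 = c 4 := eq_of_triangles (T 0 1 2 (by decide)) (T 3 0 1 (by decide))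
      (T 3 0 2 (by decide)) (T 3 1 2 (by decide)) (T 4 0 1 (by decide)) (T 4 0 2 (by decide))
      (T 4 1 2 (by decide))
    have e₂ : c 4 = c 8 := eq_of_triangles (T 5 6 7 (by decide)) (T 4 5 6 (by decide))
      (T 4 5 7 (by decide)) (T 4 6 7 (by decide)) (T 8 5 6 (by decide)) (T 8 5 7 (by decide))
      (T 8 6 7 (by decide))
    intro h
    exact (T 9 3 8 (by decide)).elim (fun h' => h' h) (fun h' => h' (e₁.trans e₂))

theorem exists_isSuperEdge {k : ℕ} (hk : 3 ≤ k) :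
    ∃ (n : ℕ) (H : SimpleGraph (Fin n)) (x y : Fin n), IsSuperEdge k H x y := by
  rcases hk.eq_or_lt with rfl | hk
  · exact ⟨_, _, _, _, isSuperEdge_triangleGadget⟩
  · exact ⟨_, _, _, _, isSuperEdge_cliqueGadget hk⟩

/-! ### Confining a cycle to a piece of a graph. -/

theorem SimpleGraph.Walk.iff_of_adj {V : Type*} {G : SimpleGraph V} {I : V → Prop} {u v : V}
    (p : G.Walk u v) (h : ∀ a ∈ p.support, ∀ b ∈ p.support, G.Adj a b → (I a ↔ I b)) :
    I u ↔ I v := by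
  induction p with
  | nil => rfl
  | cons hadj q ih =>
    rw [Walk.support_cons] at h
    exact (h _ (by simp) _ (List.mem_cons_of_mem _ q.start_mem_support) hadj).trans
      (ih fun a ha b hb => h a (List.mem_cons_of_mem _ ha) b (List.mem_cons_of_mem _ hb))

/-- A cycle stays connected when one vertex is removed. -/
theorem SimpleGraph.Walk.IsCycle.iff_of_adj {V : Type*} {G : SimpleGraph V} {I : V → Prop} {v : V}
    {p : G.Walk v v} (hp : p.IsCycle) (z : V)
    (h : ∀ a ∈ p.support, ∀ b ∈ p.support, a ≠ z → b ≠ z → G.Adj a b → (I a ↔ I b))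
    {a b : V} (ha : a ∈ p.support) (hb : b ∈ p.support) (haz : a ≠ z) (hbz : b ≠ z) :
    I a ↔ I b := by
  classical
  by_cases hz : z ∈ p.support
  -- Rotated to start at `z`, the cycle is an edge followed by a path that meets `z` only at its
  -- end.
  · have hq := hp.rotate hz
    have hm : ∀ w, w ∈ (p.rotate z hz).support ↔ w ∈ p.support := fun w =>
      Walk.mem_support_rotate_iff ..
    generalize p.rotate z hz = q at hq hm
    match q, hq, hm with
    | .nil, hq, _ => exact absurd hq Walk.not_isCycle_nil
    | .cons (v := u) hadj q, hq, hm =>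
      have hqp : q.IsPath := (Walk.cons_isCycle_iff q hadj).1 hq |>.1
      have hm' : ∀ w ∈ q.support, w ∈ p.support := fun w hw => (hm w).1 (by simp [hw])
      have key : ∀ w ∈ p.support, w ≠ z → (I u ↔ I w) := by
        intro w hw hwz
        have hw : w ∈ q.support := by
          have := (hm w).2 hw
          rw [Walk.support_cons, List.mem_cons] at this
          exact this.resolve_left hwz
        have hnot := Walk.endpoint_notMem_support_takeUntil hqp hw hwz.symm
        have hsub := q.support_takeUntil_subset_support hw
        exact (q.takeUntil w hw).iff_of_adj fun a ha b hb =>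
          h a (hm' a (hsub ha)) b (hm' b (hsub hb)) (fun h => hnot (h ▸ ha)) (fun h => hnot (h ▸ hb))
      exact (key a ha haz).symm.trans (key b hb hbz)
  · have key : ∀ w ∈ p.support, (I v ↔ I w) := by
      intro w hw
      have hsub := p.support_takeUntil_subset_support hw
      exact (p.takeUntil w hw).iff_of_adj fun a ha b hb =>
        h a (hsub ha) b (hsub hb) (fun h => hz (h ▸ hsub ha)) (fun h => hz (h ▸ hsub hb))
    exact (key a ha).symm.trans (key b hb)

/-- The cycle is pulled back to `H`. This needs an induced copy, so that every edge of the cycle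
comes from `H`. -/
theorem ValidColoring.exists_ne_of_embedding {V W : Type*} {G : SimpleGraph V} {H : SimpleGraph W}
    {k : ℕ} {d : W → Bool} (hd : ValidColoring k H d) (f : H ↪g G) {v : V} {p : G.Walk v v}
    (hp : p.IsCycle) (hl : p.length = k) (hs : ∀ a ∈ p.support, a ∈ Set.range f) :
    ∃ a b, f a ∈ p.support ∧ f b ∈ p.support ∧ d a ≠ d b := by
  let e : G.induce (Set.range f) ≃g H :=
    { toEquiv := (Equiv.ofInjective f f.injective).symm
      map_rel_iff' := by
        rintro ⟨_, a, rfl⟩ ⟨_, b, rfl⟩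
        simp [Equiv.ofInjective_symm_apply] }
  let q := p.induce (Set.range f) hs
  have hmap : q.map (Embedding.induce (Set.range f)).toHom = p := Walk.map_induce _ _
  have hq : q.IsCycle := by
    rw [← hmap] at hp
    exact hp.of_map
  have hql : q.length = k :=
    ((Walk.length_map _ _).symm.trans (congrArg Walk.length hmap)).trans hl
  have hqs : ∀ u ∈ q.support, u.1 ∈ p.support := by
    intro u hu
    rw [Walk.support_induce, List.mem_attachWith] at hu
    exact hu
  obtain ⟨a, ha, b, hb, hab⟩ := hd _ (q.map e.toHom) (hq.map e.injective)
    (by rw [Walk.length_map, hql])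
  rw [Walk.support_map, List.mem_map] at ha hb
  obtain ⟨⟨_, a, rfl⟩, ha, rfl⟩ := ha
  obtain ⟨⟨_, b, rfl⟩, hb, rfl⟩ := hb
  refine ⟨a, b, hqs _ ha, hqs _ hb, ?_⟩
  simpa [e, Equiv.ofInjective_symm_apply] using hab

/-! ### Valid colorings of the reduction graph. -/

namespace Reduction

variable {m k : ℕ} {L : Fin m → Fin k → NaeLiteral} {W : Type*} {H : SimpleGraph W} {x y : W}

theorem src_ne_tgt (s : Sup L) : src L s ≠ tgt L s := by
  rcases s with v | ⟨i, j⟩ <;> simp [src, tgt]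

@[simp]
theorem copy_left (s : Sup L) : copy L x y s x = .inl (src L s) := by
  simp [copy]

theorem copy_right (hxy : x ≠ y) (s : Sup L) : copy L x y s y = .inl (tgt L s) := by
  simp [copy, hxy.symm]

theorem copy_of_ne (s : Sup L) {w : W} (hx : w ≠ x) (hy : w ≠ y) :
    copy L x y s w = .inr (s, ⟨w, hx, hy⟩) := by
  simp [copy, hx, hy]

theorem copy_cases (hxy : x ≠ y) (s : Sup L) (w : W) :
    (w = x ∧ copy L x y s w = .inl (src L s)) ∨ (w = y ∧ copy L x y s w = .inl (tgt L s)) ∨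
      ∃ h : w ≠ x ∧ w ≠ y, copy L x y s w = .inr (s, ⟨w, h⟩) := by
  by_cases hx : w = x
  · subst hx
    exact .inl ⟨rfl, copy_left s⟩
  by_cases hy : w = y
  · subst hy
    exact .inr (.inl ⟨rfl, copy_right hxy s⟩)
  · exact .inr (.inr ⟨⟨hx, hy⟩, copy_of_ne s hx hy⟩)

theorem copy_injective (hxy : x ≠ y) (s : Sup L) : Function.Injective (copy L x y s) := by
  intro w w' h
  have hst := src_ne_tgt s
  rcases copy_cases hxy s w with ⟨rfl, e⟩ | ⟨rfl, e⟩ | ⟨hw, e⟩ <;>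
  rcases copy_cases hxy s w' with ⟨rfl, e'⟩ | ⟨rfl, e'⟩ | ⟨hw', e'⟩ <;>
  simp_all

theorem eq_of_copy_eq_inr (hxy : x ≠ y) {s s' : Sup L} {w : W} {u : {w : W // w ≠ x ∧ w ≠ y}}
    (h : copy L x y s w = .inr (s', u)) : s = s' ∧ w = u := by
  rcases copy_cases hxy s w with ⟨rfl, e⟩ | ⟨rfl, e⟩ | ⟨hw, e⟩ <;> rw [e] at h
  · simp at h
  · simp at h
  · rw [Sum.inr.injEq, Prod.mk.injEq] at h
    exact ⟨h.1, congrArg Subtype.val h.2⟩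

theorem graph_adj (hxy : x ≠ y) {a b : Vert L x y} : (graph L H x y).Adj a b ↔
    (∃ i j j', (cycleGraph k).Adj j j' ∧ a = .inl (.inr (i, j)) ∧ b = .inl (.inr (i, j'))) ∨
      ∃ s w w', H.Adj w w' ∧ a = copy L x y s w ∧ b = copy L x y s w' := by
  rw [graph, SimpleGraph.fromRel_adj]
  constructor
  · rintro ⟨-, h | ⟨i, j, j', h, rfl, rfl⟩ | ⟨s, w, w', h, rfl, rfl⟩⟩
    · exact h
    · exact .inl ⟨i, j', j, h.symm, rfl, rfl⟩
    · exact .inr ⟨s, w', w, h.symm, rfl, rfl⟩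
  · intro h
    refine ⟨?_, .inl h⟩
    rcases h with ⟨i, j, j', h, rfl, rfl⟩ | ⟨s, w, w', h, rfl, rfl⟩
    · simpa using h.ne
    · exact (copy_injective hxy s).ne h.ne

/-- The clause cycle as a subgraph. -/
def clauseHom (hxy : x ≠ y) (i : Fin m) : cycleGraph k →g graph L H x y where
  toFun j := .inl (.inr (i, j))
  map_rel' h := (graph_adj hxy).2 (.inl ⟨i, _, _, h, rfl, rfl⟩)

theorem clauseHom_injective (hxy : x ≠ y) (i : Fin m) :
    Function.Injective (clauseHom (L := L) (H := H) hxy i) := by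
  intro j j' h
  simpa [clauseHom] using h

/-- The copy of the gadget at `s` as an induced subgraph. -/
noncomputable def copyEmbedding (hadj : H.Adj x y) (s : Sup L) : H ↪g graph L H x y where
  toFun := copy L x y s
  inj' := copy_injective hadj.ne s
  map_rel_iff' := by
    intro w w'
    refine ⟨fun h => ?_, fun h => (graph_adj hadj.ne).2 (.inr ⟨s, w, w', h, rfl, rfl⟩)⟩
    have hne : w ≠ w' := fun e => h.ne (congrArg (copy L x y s) e)
    change (graph L H x y).Adj (copy L x y s w) (copy L x y s w') at h
    have hsym := hadj.symm
    rw [graph_adj hadj.ne] at h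
    -- The two ends are adjacent in `H` by hypothesis. Any other pair contains an inner vertex,
    -- which determines the copy that its edge comes from.
    rcases copy_cases hadj.ne s w with ⟨rfl, e⟩ | ⟨rfl, e⟩ | ⟨hw, e⟩ <;>
    rcases copy_cases hadj.ne s w' with ⟨rfl, e'⟩ | ⟨rfl, e'⟩ | ⟨hw', e'⟩
    · exact absurd rfl hne
    · exact hadj
    rotate_left
    · exact hsym
    · exact absurd rfl hne
    all_goals
      rcases h with ⟨i, j, j', h, h₁, h₂⟩ | ⟨s', u, u', h, h₁, h₂⟩
      · simp [e, e'] at h₁ h₂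
      · have hs : s' = s := by
          first
          | exact (eq_of_copy_eq_inr hadj.ne (h₁.symm.trans e)).1
          | exact (eq_of_copy_eq_inr hadj.ne (h₂.symm.trans e')).1
        subst hs
        rwa [copy_injective hadj.ne _ h₁, copy_injective hadj.ne _ h₂]

/-- The coloring of the variable and clause gadgets given by a truth assignment. -/
def coreColoring (L : Fin m → Fin k → NaeLiteral) (σ : ℕ → Bool) : Core L → Bool
  | .inl (v, b) => σ v == b
  | .inr (i, j) => !(σ (L i j).1 == (L i j).2)

/-- The coloring of the whole graph given by a truth assignment and a coloring of the gadget. -/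
def coloring (L : Fin m → Fin k → NaeLiteral) (x y : W) (σ : ℕ → Bool) (d : W → Bool) :
    Vert L x y → Bool
  | .inl a => coreColoring L σ a
  | .inr (s, w) => d w ^^ (d x ^^ coreColoring L σ (src L s))

theorem coreColoring_tgt (σ : ℕ → Bool) (s : Sup L) :
    coreColoring L σ (tgt L s) = !coreColoring L σ (src L s) := by
  rcases s with v | ⟨i, j⟩
  · simp [coreColoring, src, tgt]
  · rfl

theorem coloring_copy (hxy : x ≠ y) {d : W → Bool} (hd : d x ≠ d y) (σ : ℕ → Bool) (s : Sup L)
    (w : W) :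
    coloring L x y σ d (copy L x y s w) = (d w ^^ (d x ^^ coreColoring L σ (src L s))) := by
  rcases copy_cases hxy s w with ⟨rfl, e⟩ | ⟨rfl, e⟩ | ⟨hw, e⟩ <;> rw [e]
  · simp [coloring]
  · simp only [coloring, coreColoring_tgt]
    revert hd
    cases d x <;> cases d w <;> simp
  · rfl

theorem validColoring_coloring (hadj : H.Adj x y) {d : W → Bool} (hd : ValidColoring k H d)
    (hdxy : d x ≠ d y) {σ : ℕ → Bool}
    (hσ : ∀ i, (∃ j, (L i j).IsTrue σ) ∧ ∃ j, ¬ (L i j).IsTrue σ) :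
    ValidColoring k (graph L H x y) (coloring L x y σ d) := by
  classical
  intro v p hp hl
  by_contra! hmono
  -- The ends of a super-edge have different colors.
  have hst : ∀ s, .inl (src L s) ∈ p.support → .inl (tgt L s) ∉ p.support := by
    intro s h h'
    have := hmono _ h _ h'
    simp [coloring, coreColoring_tgt] at this
  by_cases hin : ∃ s w, .inr (s, w) ∈ p.support
  · obtain ⟨s, w, hw⟩ := hin
    -- `z` is the only end of `s` that `p` may contain. Off `z`, the cycle cannot leave the interior
    -- of the copy.
    obtain ⟨z, hz, hz'⟩ : ∃ z : Vert L x y,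
        (z = .inl (src L s) ∨ z = .inl (tgt L s)) ∧ ∀ a ∈ p.support,
        a ≠ z → ∀ w, a = copy L x y s w → ∃ u, a = .inr (s, u) := by
      by_cases h : .inl (src L s) ∈ p.support
      · refine ⟨.inl (src L s), .inl rfl, ?_⟩
        rintro a ha hne w rfl
        rcases copy_cases hadj.ne s w with ⟨rfl, e⟩ | ⟨rfl, e⟩ | ⟨hw, e⟩
        · exact absurd e hne
        · exact absurd (e ▸ ha) (hst s h)
        · exact ⟨_, e⟩
      · refine ⟨.inl (tgt L s), .inr rfl, ?_⟩
        rintro a ha hne w rfl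
        rcases copy_cases hadj.ne s w with ⟨rfl, e⟩ | ⟨rfl, e⟩ | ⟨hw, e⟩
        · exact absurd (e ▸ ha) h
        · exact absurd e hne
        · exact ⟨_, e⟩
    have hstep : ∀ a ∈ p.support, ∀ b ∈ p.support, b ≠ z → (graph L H x y).Adj a b →
        (∃ u, a = .inr (s, u)) → ∃ u, b = .inr (s, u) := by
      rintro a ha b hb hbz hab ⟨u, hu⟩
      rcases (graph_adj hadj.ne).1 hab with ⟨i, j, j', -, h₁, -⟩ | ⟨s', w, w', -, h₁, h₂⟩
      · simp [h₁] at hu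
      · obtain ⟨rfl, -⟩ := eq_of_copy_eq_inr hadj.ne (h₁.symm.trans hu)
        exact hz' b hb hbz w' h₂
    have hrange : ∀ a ∈ p.support, a ∈ Set.range (copyEmbedding (L := L) hadj s) := by
      intro a ha
      by_cases haz : a = z
      · rcases hz with hz | hz <;> rw [haz, hz]
        exacts [⟨x, copy_left s⟩, ⟨y, copy_right hadj.ne s⟩]
      have hwz : .inr (s, w) ≠ z := by rcases hz with rfl | rfl <;> simp
      obtain ⟨u, rfl⟩ := (hp.iff_of_adj (I := fun a => ∃ u, a = .inr (s, u)) z (fun a ha b hb haz hbz hab =>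
          ⟨hstep a ha b hb hbz hab, hstep b hb a ha haz hab.symm⟩) hw ha hwz haz).1 ⟨w, rfl⟩
      exact ⟨u, copy_of_ne s u.2.1 u.2.2⟩
    obtain ⟨a, b, ha, hb, hab⟩ := hd.exists_ne_of_embedding (copyEmbedding hadj s) hp hl hrange
    have := hmono _ ha _ hb
    change coloring L x y σ d (copy L x y s a) = coloring L x y σ d (copy L x y s b) at this
    -- On one copy the coloring is `d` up to a constant flip.
    rw [coloring_copy hadj.ne hdxy, coloring_copy hadj.ne hdxy] at this
    exact hab (by simpa using this)
  · push Not at hin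
    -- Without inner vertices, an edge from a copy would join the two differently colored ends, so
    -- only clause edges remain.
    have hcl : ∀ a ∈ p.support, ∀ b ∈ p.support, (graph L H x y).Adj a b →
        ∃ i j j', a = .inl (.inr (i, j)) ∧ b = .inl (.inr (i, j')) := by
      intro a ha b hb hab
      have hne := hab.ne
      rcases (graph_adj hadj.ne).1 hab with ⟨i, j, j', -, h₁, h₂⟩ | ⟨s, w, w', h, h₁, h₂⟩
      · exact ⟨i, j, j', h₁, h₂⟩
      · exfalso
        subst h₁ h₂
        rcases copy_cases hadj.ne s w with ⟨rfl, e⟩ | ⟨rfl, e⟩ | ⟨hw, e⟩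
        · rcases copy_cases hadj.ne s w' with ⟨rfl, e'⟩ | ⟨rfl, e'⟩ | ⟨hw', e'⟩
          · exact hne rfl
          · exact hst s (e ▸ ha) (e' ▸ hb)
          · exact hin _ _ (e' ▸ hb)
        · rcases copy_cases hadj.ne s w' with ⟨rfl, e'⟩ | ⟨rfl, e'⟩ | ⟨hw', e'⟩
          · exact hst s (e' ▸ hb) (e ▸ ha)
          · exact hne rfl
          · exact hin _ _ (e' ▸ hb)
        · exact hin _ _ (e ▸ ha)
    obtain ⟨b, hb, -, -, -, hvb, -⟩ := hp.exists_two_neighbors p.start_mem_support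
    obtain ⟨i, j₀, -, rfl, -⟩ := hcl _ p.start_mem_support b hb hvb
    have hall : ∀ a ∈ p.support, ∃ j, a = .inl (.inr (i, j)) := by
      intro a ha
      have hsub := p.support_takeUntil_subset_support ha
      refine ((p.takeUntil a ha).iff_of_adj (I := fun a => ∃ j, a = .inl (.inr (i, j))) ?_).1
        ⟨j₀, rfl⟩
      intro a ha b hb hab
      obtain ⟨i', j, j', rfl, rfl⟩ := hcl a (hsub ha) b (hsub hb) hab
      simp
    let S : Finset (Vert L x y) := Finset.univ.image fun j : Fin k => .inl (.inr (i, j))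
    have hS : S.card ≤ p.length := by
      rw [hl]
      exact Finset.card_image_le.trans_eq (Finset.card_fin k)
    have hmem : ∀ j : Fin k, (.inl (.inr (i, j)) : Vert L x y) ∈ p.support := fun j =>
      hp.mem_support_of_card_le (s := S)
        (fun u hu => by obtain ⟨j, rfl⟩ := hall u hu; simp [S]) hS (by simp [S])
    obtain ⟨⟨j, hj⟩, j', hj'⟩ := hσ i
    have := hmono _ (hmem j) _ (hmem j')
    simp only [coloring, coreColoring] at this
    simp only [NaeLiteral.IsTrue] at hj hj'
    simp [hj, hj'] at this

theorem exists_validColoring_iff (hk : 3 ≤ k) (hH : IsSuperEdge k H x y) :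
    (∃ c, ValidColoring k (graph L H x y) c) ↔
      ∃ σ : ℕ → Bool, ∀ i, (∃ j, (L i j).IsTrue σ) ∧ ∃ j, ¬ (L i j).IsTrue σ := by
  classical
  obtain ⟨hadj, ⟨d, hd⟩, hforce⟩ := hH
  refine ⟨?_, fun ⟨σ, hσ⟩ => ⟨_, validColoring_coloring hadj hd (hforce d hd) hσ⟩⟩
  rintro ⟨c, hc⟩
  have hst : ∀ s, c (.inl (src L s)) ≠ c (.inl (tgt L s)) := by
    intro s
    have := hforce _ (hc.comap (copyEmbedding hadj s).toHom (copyEmbedding hadj s).injective)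
    change c (copy L x y s x) ≠ c (copy L x y s y) at this
    rwa [copy_left, copy_right hadj.ne] at this
  -- Variables that do not occur have no vertex; their value is irrelevant.
  refine ⟨fun v => if h : ∃ i j, (L i j).1 = v then c (.inl (.inl (⟨v, h⟩, true))) else true, ?_⟩
  set σ : ℕ → Bool :=
    fun v => if h : ∃ i j, (L i j).1 = v then c (.inl (.inl (⟨v, h⟩, true))) else true with hσ
  have key : ∀ i j, (L i j).IsTrue σ ↔ c (.inl (.inr (i, j))) = false := by
    intro i j
    have hv : ∃ i' j', (L i' j').1 = (L i j).1 := ⟨i, j, rfl⟩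
    have h₁ := hst (.inl ⟨(L i j).1, hv⟩)
    have h₂ := hst (.inr (i, j))
    have h₃ : σ (L i j).1 = c (.inl (.inl (⟨(L i j).1, hv⟩, true))) := dif_pos hv
    rw [NaeLiteral.IsTrue, h₃]
    simp only [src, tgt] at h₁ h₂
    generalize (L i j).2 = b at h₂ ⊢
    -- A negative literal needs both super-edges, from the clause vertex to `¬v` and from `¬v` to
    -- `v`; a positive one needs only the first kind.
    cases b
    · revert h₁ h₂
      generalize c (.inl (.inl (⟨(L i j).1, hv⟩, true))) = b₁
      generalize c (.inl (.inl (⟨(L i j).1, hv⟩, false))) = b₂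
      generalize c (.inl (.inr (i, j))) = b₃
      revert b₁ b₂ b₃
      decide
    · revert h₂
      generalize c (.inl (.inl (⟨(L i j).1, hv⟩, true))) = b₁
      generalize c (.inl (.inr (i, j))) = b₃
      revert b₁ b₃
      decide
  intro i
  obtain ⟨n, rfl⟩ : ∃ n, k = n + 3 := ⟨k - 3, by omega⟩
  obtain ⟨a, -, b, -, hab⟩ := hc.comap (clauseHom hadj.ne i) (clauseHom_injective hadj.ne i) 0
    (cycleGraph.cycle n) cycleGraph.isCycle_cycle cycleGraph.length_cycle
  simp only [key]
  change c (.inl (.inr (i, a))) ≠ c (.inl (.inr (i, b))) at hab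
  cases ha : c (.inl (.inr (i, a))) <;> cases hb : c (.inl (.inr (i, b)))
  · simp [ha, hb] at hab
  · exact ⟨⟨a, ha⟩, b, by simp [hb]⟩
  · exact ⟨⟨b, hb⟩, a, by simp [ha]⟩
  · simp [ha, hb] at hab

end Reduction

/-! ### Graph codes from lists of named vertices and edges. -/

section Code

variable {T : Type*} [DecidableEq T]

/-- The elements of a list without repetitions. -/
def List.distinct (l : List T) : List T := l.foldr List.insert []

theorem List.mem_distinct {l : List T} {a : T} : a ∈ l.distinct ↔ a ∈ l := by
  induction l with
  | nil => simp [List.distinct]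
  | cons b l ih =>
    change a ∈ List.insert b l.distinct ↔ _
    rw [List.mem_insert_iff, ih, List.mem_cons]

theorem List.nodup_distinct (l : List T) : l.distinct.Nodup := by
  induction l with
  | nil => simp [List.distinct]
  | cons b l ih => exact ih.insert

/-- The code of the graph with the vertices `V` and the edges `E`. -/
def GraphCode.ofLists (V : List T) (E : List (T × T)) : GraphCode :=
  (V.distinct.length, E.map fun e => (V.distinct.idxOf e.1, V.distinct.idxOf e.2))

theorem GraphCode.nonempty_iso_ofLists {X : Type*} {r : X → X → Prop} {V : List T}
    {E : List (T × T)} (t : X → T) (ht : Function.Injective t) (hV : ∀ a, a ∈ V ↔ ∃ u, t u = a)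
    (hE : ∀ u v, (t u, t v) ∈ E ↔ r u v) :
    Nonempty ((GraphCode.ofLists V E).graph ≃g SimpleGraph.fromRel r) := by
  have hX : ∀ a, a ∈ Set.range t ↔ a ∈ V.distinct := fun a => by
    rw [List.mem_distinct, hV]; rfl
  let e : X ≃ Fin V.distinct.length := (Equiv.ofInjective t ht).trans
    ((Equiv.subtypeEquivRight hX).trans (List.Nodup.getEquiv _ V.nodup_distinct).symm)
  have he : ∀ u, (e u).1 = V.distinct.idxOf (t u) := fun u => rfl
  have key : ∀ u v, ((e u).1, (e v).1) ∈ (GraphCode.ofLists V E).2 ↔ r u v := by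
    intro u v
    rw [← hE, he, he, GraphCode.ofLists, List.mem_map]
    constructor
    · rintro ⟨⟨a, b⟩, hab, h⟩
      rw [Prod.mk.injEq] at h
      have hu : t u ∈ V.distinct := (hX _).1 ⟨u, rfl⟩
      have hv : t v ∈ V.distinct := (hX _).1 ⟨v, rfl⟩
      -- A name missing from the list has the length of the list as its index, so it cannot collide
      -- with the listed name `t u`.
      obtain rfl : t u = a := (List.idxOf_inj hu).1 h.1.symm
      obtain rfl : t v = b := (List.idxOf_inj hv).1 h.2.symm
      exact hab
    · exact fun h => ⟨_, h, rfl⟩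
  refine ⟨(RelIso.symm ⟨e, ?_⟩)⟩
  intro u v
  rw [GraphCode.graph, SimpleGraph.fromRel_adj, SimpleGraph.fromRel_adj]
  refine and_congr e.injective.ne_iff (or_congr (key u v) (key v u))

end Code

/-! ### Primitive recursiveness of the construction. -/

theorem Primrec.list_mem {α : Type*} [Primcodable α] [DecidableEq α] :
    PrimrecRel fun (a : α) (l : List α) => a ∈ l := by
  refine (Primrec.nat_lt.comp₂ Primrec.list_idxOf (Primrec.list_length.comp .snd).to₂).of_eq ?_
  intro a l
  exact List.idxOf_lt_length_iff

theorem Primrec.list_insert {α : Type*} [Primcodable α] [DecidableEq α] :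
    Primrec₂ fun (a : α) (l : List α) => List.insert a l := by
  refine (Primrec.ite (c := fun p : α × List α => p.1 ∈ p.2) (Primrec.list_mem.comp .fst .snd) .snd
    Primrec.list_cons).of_eq ?_
  rintro ⟨a, l⟩
  by_cases h : a ∈ l <;> simp [h]

theorem Primrec.list_distinct {α : Type*} [Primcodable α] [DecidableEq α] :
    Primrec fun l : List α => l.distinct :=
  Primrec.list_foldr .id (.const [])
    (Primrec.list_insert.comp₂ (Primrec.fst.comp .snd).to₂ (Primrec.snd.comp .snd).to₂)

theorem Primrec.graphCode_ofLists {α T : Type*} [Primcodable α] [Primcodable T] [DecidableEq T]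
    {V : α → List T} {E : α → List (T × T)} (hV : Primrec V) (hE : Primrec E) :
    Primrec fun a => GraphCode.ofLists (V a) (E a) := by
  have hD : Primrec fun a => (V a).distinct := Primrec.list_distinct.comp hV
  refine .pair (Primrec.list_length.comp hD) (Primrec.list_map hE ?_)
  exact Primrec.pair
    (Primrec.list_idxOf.comp (Primrec.fst.comp .snd) (hD.comp .fst))
    (Primrec.list_idxOf.comp (Primrec.snd.comp .snd) (hD.comp .fst))

namespace Reduction

/-- Names for the vertices of the variable and clause gadgets. -/
abbrev CoreName : Type := (ℕ × Bool) ⊕ (ℕ × ℕ)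

/-- Names for the super-edges. -/
abbrev SupName : Type := ℕ ⊕ (ℕ × ℕ)

/-- Names for the vertices of the whole graph. -/
abbrev VertName : Type := CoreName ⊕ (SupName × ℕ)

/-- The positions of the clauses of a formula, with the literals that they are labeled with. -/
def positions (k : ℕ) (φ : NaeFormula) : List ((ℕ × ℕ) × NaeLiteral) :=
  (List.range φ.length).flatMap fun i => (List.range k).map fun j =>
    ((i, j), (φ.getD i []).getD (j % (φ.getD i []).length) (0, true))

/-- The super-edges with their ends, by name. -/
def supNames (k : ℕ) (φ : NaeFormula) : List (SupName × CoreName × CoreName) :=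
  (positions k φ).flatMap fun p =>
    [(.inl p.2.1, .inl (p.2.1, true), .inl (p.2.1, false)), (.inr p.1, .inl p.2, .inr p.1)]

/-- The name of the copy at `s` of a vertex of the gadget. -/
def copyName (x y : ℕ) (s : SupName × CoreName × CoreName) (w : ℕ) : VertName :=
  if w = x then .inl s.2.1 else if w = y then .inl s.2.2 else .inr (s.1, w)

/-- The names of all vertices. -/
def vertNames (k n x y : ℕ) (φ : NaeFormula) : List VertName :=
  (supNames k φ).flatMap fun s => (List.range n).map (copyName x y s)

/-- The edges of the whole graph, for the clause cycles with the edges `F` and the gadget with the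
edges `E`. -/
def edgeNames (k x y : ℕ) (F E : List (ℕ × ℕ)) (φ : NaeFormula) : List (VertName × VertName) :=
  ((List.range φ.length).flatMap fun i => F.map fun e =>
    ((.inl (.inr (i, e.1)), .inl (.inr (i, e.2))) : VertName × VertName)) ++
  (supNames k φ).flatMap fun s => E.map fun e => (copyName x y s e.1, copyName x y s e.2)

theorem primrec_positions (k : ℕ) : Primrec (positions k) := by
  refine Primrec.list_flatMap (Primrec.list_range.comp .list_length) ?_
  refine Primrec.list_map (.const _) ?_
  have hC : Primrec fun q : (NaeFormula × ℕ) × ℕ => q.1.1.getD q.1.2 [] :=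
    (Primrec.list_getD []).comp (Primrec.fst.comp .fst) (Primrec.snd.comp .fst)
  refine Primrec.pair (Primrec.pair (Primrec.snd.comp .fst) .snd) ?_
  exact (Primrec.list_getD _).comp hC (Primrec.nat_mod.comp .snd (Primrec.list_length.comp hC))

theorem primrec_supNames (k : ℕ) : Primrec (supNames k) := by
  refine Primrec.list_flatMap (primrec_positions k) ?_
  have hp : Primrec fun q : NaeFormula × ((ℕ × ℕ) × NaeLiteral) => q.2 := .snd
  have hv := Primrec.fst.comp (Primrec.snd.comp hp)
  have h₁ : Primrec fun q : NaeFormula × ((ℕ × ℕ) × NaeLiteral) =>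
      ((.inl q.2.2.1, .inl (q.2.2.1, true), .inl (q.2.2.1, false)) :
        SupName × CoreName × CoreName) :=
    .pair (Primrec.sumInl.comp hv) (.pair (Primrec.sumInl.comp (.pair hv (.const _)))
      (Primrec.sumInl.comp (.pair hv (.const _))))
  have h₂ : Primrec fun q : NaeFormula × ((ℕ × ℕ) × NaeLiteral) =>
      ((.inr q.2.1, .inl q.2.2, .inr q.2.1) : SupName × CoreName × CoreName) :=
    .pair (Primrec.sumInr.comp (Primrec.fst.comp hp))
      (.pair (Primrec.sumInl.comp (Primrec.snd.comp hp)) (Primrec.sumInr.comp (Primrec.fst.comp hp)))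
  exact Primrec.list_cons.comp h₁ (Primrec.list_cons.comp h₂ (.const []))

theorem primrec_copyName (x y : ℕ) : Primrec₂ (copyName x y) := by
  refine Primrec.ite (Primrec.eq.comp .snd (.const x))
    (Primrec.sumInl.comp (Primrec.fst.comp (Primrec.snd.comp .fst)))
    (Primrec.ite (Primrec.eq.comp .snd (.const y))
      (Primrec.sumInl.comp (Primrec.snd.comp (Primrec.snd.comp .fst)))
      (Primrec.sumInr.comp (.pair (Primrec.fst.comp .fst) .snd)))

theorem primrec_vertNames (k n x y : ℕ) : Primrec (vertNames k n x y) := by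
  refine Primrec.list_flatMap (primrec_supNames k) ?_
  exact Primrec.list_map (.const _)
    ((primrec_copyName x y).comp (Primrec.snd.comp .fst) .snd)

/-- `F` and `E` are constants independent of the formula, so they may be chosen noncomputably. -/
theorem primrec_edgeNames (k x y : ℕ) (F E : List (ℕ × ℕ)) : Primrec (edgeNames k x y F E) := by
  refine Primrec.list_append.comp ?_ ?_
  · refine Primrec.list_flatMap (Primrec.list_range.comp .list_length) ?_
    refine Primrec.list_map (.const _) ?_
    have hi : Primrec fun q : (NaeFormula × ℕ) × (ℕ × ℕ) => q.1.2 := Primrec.snd.comp .fst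
    exact Primrec.pair
      (Primrec.sumInl.comp (Primrec.sumInr.comp (.pair hi (Primrec.fst.comp .snd))))
      (Primrec.sumInl.comp (Primrec.sumInr.comp (.pair hi (Primrec.snd.comp .snd))))
  · refine Primrec.list_flatMap (primrec_supNames k) ?_
    refine Primrec.list_map (.const _) ?_
    have hs : Primrec fun q : (NaeFormula × (SupName × CoreName × CoreName)) × (ℕ × ℕ) => q.1.2 :=
      Primrec.snd.comp .fst
    exact Primrec.pair ((primrec_copyName x y).comp hs (Primrec.fst.comp .snd))
      ((primrec_copyName x y).comp hs (Primrec.snd.comp .snd))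

end Reduction

/-! ### The named graph is the reduction graph. -/

namespace Reduction

variable {k n : ℕ} {φ : NaeFormula}

/-- The name of a vertex of a variable or clause gadget. -/
def coreName {m : ℕ} {L : Fin m → Fin k → NaeLiteral} : Core L → CoreName
  | .inl (v, b) => .inl (v.1, b)
  | .inr (i, j) => .inr (i.1, j.1)

/-- The name of a super-edge. -/
def supName {m : ℕ} {L : Fin m → Fin k → NaeLiteral} : Sup L → SupName
  | .inl v => .inl v.1
  | .inr (i, j) => .inr (i.1, j.1)

/-- The name of a vertex. -/
def vertName {m : ℕ} {L : Fin m → Fin k → NaeLiteral} {x y : Fin n} : Vert L x y → VertName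
  | .inl a => .inl (coreName a)
  | .inr (s, w) => .inr (supName s, w.1.1)

section

variable {m : ℕ} {L : Fin m → Fin k → NaeLiteral} {x y : Fin n}

theorem coreName_injective : Function.Injective (coreName (L := L)) := by
  rintro (⟨⟨v, hv⟩, b⟩ | ⟨i, j⟩) (⟨⟨v', hv'⟩, b'⟩ | ⟨i', j'⟩) h <;>
    simp_all [coreName, Fin.ext_iff]

theorem supName_injective : Function.Injective (supName (L := L)) := by
  rintro (⟨v, hv⟩ | ⟨i, j⟩) (⟨v', hv'⟩ | ⟨i', j'⟩) h <;> simp_all [supName, Fin.ext_iff]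

theorem vertName_injective : Function.Injective (vertName (L := L) (x := x) (y := y)) := by
  rintro (a | ⟨s, w⟩) (b | ⟨s', w'⟩) h
  · simpa [vertName, coreName_injective.eq_iff] using h
  · simp [vertName] at h
  · simp [vertName] at h
  · simpa [vertName, supName_injective.eq_iff, Fin.ext_iff, Subtype.ext_iff] using h

/-- The name of a super-edge with those of its ends. -/
def supData (s : Sup L) : SupName × CoreName × CoreName :=
  (supName s, coreName (src L s), coreName (tgt L s))

theorem copyName_supData (hxy : x ≠ y) (s : Sup L) (w : Fin n) :
    copyName x y (supData s) w = vertName (copy L x y s w) := by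
  have hxy' := Fin.val_ne_of_ne hxy
  rcases copy_cases hxy s w with ⟨rfl, e⟩ | ⟨rfl, e⟩ | ⟨⟨hx, hy⟩, e⟩
  · simp [copyName, supData, vertName]
  · simp [e, copyName, supData, vertName, hxy'.symm]
  · simp [e, copyName, supData, vertName, Fin.val_ne_of_ne hx, Fin.val_ne_of_ne hy]

/-- Every core vertex is an end of some super-edge; this is why `vertNames` need only list the
copies. -/
theorem exists_copy_eq (hxy : x ≠ y) (a : Vert L x y) : ∃ s w, a = copy L x y s w := by
  rcases a with (⟨⟨v, i, j, rfl⟩, _ | _⟩ | ⟨i, j⟩) | ⟨s, w, hw⟩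
  · exact ⟨.inl ⟨_, i, j, rfl⟩, y, by rw [copy_right hxy]; rfl⟩
  · exact ⟨.inl ⟨_, i, j, rfl⟩, x, by rw [copy_left]; rfl⟩
  · exact ⟨.inr (i, j), y, by rw [copy_right hxy]; rfl⟩
  · exact ⟨s, w, by rw [copy_of_ne s hw.1 hw.2]⟩

end

theorem mem_positions {p : (ℕ × ℕ) × NaeLiteral} : p ∈ positions k φ ↔
    ∃ (i : Fin φ.length) (j : Fin k), p = ((i.1, j.1), φ.litAt k i j) := by
  have h : ∀ (i : Fin φ.length), φ.getD i.1 [] = φ.get i := fun i => by simp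
  simp only [positions, List.mem_flatMap, List.mem_map, List.mem_range]
  constructor
  · rintro ⟨i, hi, j, hj, rfl⟩
    refine ⟨⟨i, hi⟩, ⟨j, hj⟩, ?_⟩
    rw [NaeFormula.litAt, h ⟨i, hi⟩]
  · rintro ⟨i, j, rfl⟩
    refine ⟨i, i.2, j, j.2, ?_⟩
    rw [NaeFormula.litAt, h]

theorem mem_supNames {s : SupName × CoreName × CoreName} : s ∈ supNames k φ ↔
    ∃ t : Sup (φ.litAt k), s = supData t := by
  simp only [supNames, List.mem_flatMap, mem_positions, List.mem_cons, List.not_mem_nil, or_false]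
  constructor
  · rintro ⟨_, ⟨i, j, rfl⟩, rfl | rfl⟩
    · exact ⟨.inl ⟨_, i, j, rfl⟩, rfl⟩
    · exact ⟨.inr (i, j), rfl⟩
  · rintro ⟨⟨v, i, j, rfl⟩ | ⟨i, j⟩, rfl⟩
    · exact ⟨_, ⟨i, j, rfl⟩, .inl rfl⟩
    · exact ⟨_, ⟨i, j, rfl⟩, .inr rfl⟩

theorem mem_vertNames {x y : Fin n} (hxy : x ≠ y) {a : VertName} :
    a ∈ vertNames k n x y φ ↔ ∃ u : Vert (φ.litAt k) x y, vertName u = a := by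
  simp only [vertNames, List.mem_flatMap, mem_supNames, List.mem_map, List.mem_range]
  constructor
  · rintro ⟨_, ⟨s, rfl⟩, w, hw, rfl⟩
    exact ⟨_, (copyName_supData hxy s ⟨w, hw⟩).symm⟩
  · rintro ⟨u, rfl⟩
    obtain ⟨s, w, rfl⟩ := exists_copy_eq hxy u
    exact ⟨_, ⟨s, rfl⟩, w, w.2, copyName_supData hxy s w⟩

/-- The list of the edges of a graph, by the values of their end points. -/
noncomputable def edgeList {n : ℕ} (G : SimpleGraph (Fin n)) : List (ℕ × ℕ) := by
  classical
  exact (Finset.univ.filter fun e : Fin n × Fin n => G.Adj e.1 e.2).toList.map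
    fun e => (e.1.1, e.2.1)

theorem mem_edgeList {n : ℕ} {G : SimpleGraph (Fin n)} {e : ℕ × ℕ} :
    e ∈ edgeList G ↔ ∃ a b, G.Adj a b ∧ e = (a.1, b.1) := by
  simp only [edgeList, List.mem_map, Finset.mem_toList, Finset.mem_filter, Finset.mem_univ,
    true_and, Prod.exists]
  exact exists₂_congr fun a b => and_congr_right fun _ => eq_comm

theorem mem_edgeNames {H : SimpleGraph (Fin n)} {x y : Fin n} (hxy : x ≠ y)
    {u v : Vert (φ.litAt k) x y} :
    (vertName u, vertName v) ∈ edgeNames k x y (edgeList (cycleGraph k)) (edgeList H) φ ↔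
      (∃ i j j', (cycleGraph k).Adj j j' ∧ u = .inl (.inr (i, j)) ∧ v = .inl (.inr (i, j'))) ∨
        ∃ s w w', H.Adj w w' ∧ u = copy (φ.litAt k) x y s w ∧ v = copy (φ.litAt k) x y s w' := by
  simp only [edgeNames, List.mem_append, List.mem_flatMap, mem_supNames, List.mem_map,
    List.mem_range, mem_edgeList]
  refine or_congr ⟨?_, ?_⟩ ⟨?_, ?_⟩
  · rintro ⟨i, hi, _, ⟨j, j', h, rfl⟩, he⟩
    rw [Prod.mk.injEq] at he
    exact ⟨⟨i, hi⟩, j, j', h, vertName_injective he.1.symm, vertName_injective he.2.symm⟩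
  · rintro ⟨i, j, j', h, rfl, rfl⟩
    exact ⟨i, i.2, _, ⟨j, j', h, rfl⟩, rfl⟩
  · rintro ⟨_, ⟨s, rfl⟩, _, ⟨w, w', h, rfl⟩, he⟩
    rw [Prod.mk.injEq, copyName_supData hxy, copyName_supData hxy] at he
    exact ⟨s, w, w', h, vertName_injective he.1.symm, vertName_injective he.2.symm⟩
  · rintro ⟨s, w, w', h, rfl, rfl⟩
    exact ⟨_, ⟨s, rfl⟩, _, ⟨w, w', h, rfl⟩, by
      rw [copyName_supData hxy, copyName_supData hxy]⟩

theorem nonempty_iso_graph {H : SimpleGraph (Fin n)} {x y : Fin n} (hxy : x ≠ y) :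
    Nonempty ((GraphCode.ofLists (vertNames k n x y φ)
      (edgeNames k x y (edgeList (cycleGraph k)) (edgeList H) φ)).graph ≃g
        graph (φ.litAt k) H x y) :=
  GraphCode.nonempty_iso_ofLists vertName vertName_injective (fun _ => mem_vertNames hxy)
    fun _ _ => mem_edgeNames hxy

end Reduction

/-! ### Padded clauses, malformed formulas and the theorem. -/

theorem NaeFormula.exists_litAt_iff {k : ℕ} {φ : NaeFormula} {i : Fin φ.length}
    (hC : φ.get i ≠ []) (hk : (φ.get i).length ≤ k) (P : NaeLiteral → Prop) :
    (∃ j, P (φ.litAt k i j)) ↔ ∃ l ∈ φ.get i, P l := by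
  have hpos := List.length_pos_iff.2 hC
  constructor
  · rintro ⟨j, hj⟩
    have hlt := Nat.mod_lt j.1 hpos
    -- The clause is nonempty, so the default literal `(0, true)` is never used.
    rw [NaeFormula.litAt, List.getD_eq_getElem _ _ hlt] at hj
    exact ⟨_, List.getElem_mem hlt, hj⟩
  · rintro ⟨l, hl, hP⟩
    obtain ⟨j, hj, rfl⟩ := List.getElem_of_mem hl
    refine ⟨⟨j, hj.trans_le hk⟩, ?_⟩
    rw [NaeFormula.litAt]
    dsimp only
    rwa [Nat.mod_eq_of_lt hj, List.getD_eq_getElem _ _ hj]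

theorem mem_naeSat_iff {k : ℕ} {φ : NaeFormula} (hφ : ∀ C ∈ φ, C ≠ [] ∧ C.length ≤ k) :
    φ ∈ NaeSat k ↔ ∃ σ : ℕ → Bool, ∀ i, (∃ j, (φ.litAt k i j).IsTrue σ) ∧
      ∃ j, ¬ (φ.litAt k i j).IsTrue σ := by
  have h : ∀ (σ : ℕ → Bool) (i : Fin φ.length), ((∃ j, (φ.litAt k i j).IsTrue σ) ∧
      ∃ j, ¬ (φ.litAt k i j).IsTrue σ) ↔ NaeClause.Holds σ (φ.get i) := by
    intro σ i
    obtain ⟨hC, hk⟩ := hφ _ (φ.get_mem i)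
    rw [NaeFormula.exists_litAt_iff hC hk fun l => l.IsTrue σ,
      NaeFormula.exists_litAt_iff hC hk fun l => ¬ l.IsTrue σ]
    rfl
  simp only [h]
  rw [NaeSat, Set.mem_ofPred_eq, and_iff_right fun C hC => (hφ C hC).2]
  exact exists_congr fun σ => List.forall_mem_iff_get

theorem of_mem_naeSat {k : ℕ} {φ : NaeFormula} (h : φ ∈ NaeSat k) :
    ∀ C ∈ φ, C ≠ [] ∧ C.length ≤ k := by
  obtain ⟨hk, σ, hσ⟩ := h
  refine fun C hC => ⟨?_, hk C hC⟩
  rintro rfl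
  obtain ⟨⟨l, hl, -⟩, -⟩ := hσ _ hC
  simp at hl

/-- The code of the complete graph with `n` vertices. -/
def GraphCode.complete (n : ℕ) : GraphCode :=
  (n, (List.range n).flatMap fun a => (List.range n).map fun b => (a, b))

theorem GraphCode.complete_notMem_twoCol {k : ℕ} (hk : 3 ≤ k) :
    GraphCode.complete (2 * k - 1) ∉ TwoCol k := by
  rintro ⟨c, hc⟩
  refine not_validColoring_of_isClique hk (s := Finset.univ) ?_ ?_ c hc
  · intro a _ b _ hab
    rw [GraphCode.graph, SimpleGraph.fromRel_adj]
    refine ⟨hab, .inl ?_⟩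
    have ha : a.1 < 2 * k - 1 := a.2
    have hb : b.1 < 2 * k - 1 := b.2
    simp [GraphCode.complete, ha, hb]
  · exact (Finset.card_fin _).ge

theorem primrecPred_forall_length_le (k : ℕ) :
    PrimrecPred fun φ : NaeFormula => ∀ C ∈ φ, C ≠ [] ∧ C.length ≤ k := by
  refine PrimrecPred.forall_mem_list ?_
  refine ((Primrec.nat_lt.comp (.const 0) .list_length).and
    (Primrec.nat_le.comp .list_length (.const k))).of_eq fun C => ?_
  rw [List.length_pos_iff]

theorem theorem2 (k : ℕ) (hk : 3 ≤ k) :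
    ∃ f : NaeFormula → GraphCode,
      Computable f ∧
      (∀ φ : NaeFormula, φ ∈ NaeSat k ↔ f φ ∈ TwoCol k) ∧
      ∃ (n : ℕ) (H : SimpleGraph (Fin n)) (x y : Fin n),
        IsSuperEdge k H x y ∧
        ∀ φ : NaeFormula, (∀ C ∈ φ, C ≠ [] ∧ C.length ≤ k) →
          Nonempty ((f φ).graph ≃g Reduction.graph (φ.litAt k) H x y) := by
  classical
  obtain ⟨n, H, x, y, hH⟩ := exists_isSuperEdge hk
  let g : NaeFormula → GraphCode := fun φ => GraphCode.ofLists (Reduction.vertNames k n x y φ)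
    (Reduction.edgeNames k x y (Reduction.edgeList (cycleGraph k)) (Reduction.edgeList H) φ)
  have hiso : ∀ φ : NaeFormula, Nonempty ((g φ).graph ≃g Reduction.graph (φ.litAt k) H x y) :=
    fun φ => Reduction.nonempty_iso_graph hH.1.ne
  -- An empty clause has no true literal, so formulas failing the test are outside `NaeSat k` and
  -- may go to a fixed graph without valid coloring.
  refine ⟨fun φ => if ∀ C ∈ φ, C ≠ [] ∧ C.length ≤ k then g φ else GraphCode.complete (2 * k - 1),
    ?_, fun φ => ?_, n, H, x, y, hH, fun φ hφ => ?_⟩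
  · exact (Primrec.ite (primrecPred_forall_length_le k)
      (Primrec.graphCode_ofLists (Reduction.primrec_vertNames ..) (Reduction.primrec_edgeNames ..))
      (.const _)).to_comp
  · dsimp only
    by_cases hφ : ∀ C ∈ φ, C ≠ [] ∧ C.length ≤ k
    · obtain ⟨e⟩ := hiso φ
      rw [if_pos hφ, mem_naeSat_iff hφ, ← Reduction.exists_validColoring_iff hk hH]
      exact (exists_validColoring_congr e).symm
    · rw [if_neg hφ]
      exact iff_of_false (fun h => hφ (of_mem_naeSat h)) (GraphCode.complete_notMem_twoCol hk)
  · dsimp only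
    rw [if_pos hφ]
    exact hiso φ
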